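/- Let $\mathcal{C}$ be a Grothendieck category. A full subcategory of $\mathcal{C}$ is called \emph{localizing} if it is closed under subobjects, quotient objects, extensions and arbitrary direct sums, and a localizing subcategory is called \emph{stable} if it is closed under essential extensions. For a localizing subcategory $\mathcal{L}$ let $\mathcal{C}/\mathcal{L}$ be the quotient category (with the same objects as $\mathcal{C}$). Let $\mathcal{L}_0$ and $\mathcal{L}_1$ be stable localizing subcategories of $\mathcal{C}$, and let $\mathcal{L}_0 \vee \mathcal{L}_1$ be the smallest localizing subcategory containing both. Consider the natural functors, for $i = 0, 1$, $$Q_i : \mathcal{C}/(\mathcal{L}_0 \cap \mathcal{L}_1) \to \mathcal{C}/\mathcal{L}_i, \qquad F_i : \mathcal{C}/\mathcal{L}_i \to \mathcal{C}/(\mathcal{L}_0 \vee \mathcal{L}_1),$$ so that $F_0 Q_0 = F_1 Q_1$. Let $\mathcal{D} = (\mathcal{C}/\mathcal{L}_0) \times_{\mathcal{C}/(\mathcal{L}_0 \vee \mathcal{L}_1)} (\mathcal{C}/\mathcal{L}_1)$ be Gabriel's recollement category: its objects are the triples $\Theta = (X_0, X_1, \sigma)$ with $X_i$ an object of $\mathcal{C}/\mathcal{L}_i$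 and $\sigma : F_0(X_0) \to F_1(X_1)$ an isomorphism, and its morphisms $(X_0, X_1, \sigma) \to (X_0', X_1', \sigma')$ are the pairs $(f_0, f_1)$ of morphisms $f_i : X_i \to X_i'$ with $\sigma' \circ F_0(f_0) = F_1(f_1) \circ \sigma$. Let $R : \mathcal{C}/(\mathcal{L}_0 \cap \mathcal{L}_1) \to \mathcal{D}$ be the functor $R(X) = (Q_0(X), Q_1(X), \mathrm{id})$, $R(f) = (Q_0(f), Q_1(f))$. The functors $Q_i$ and $F_i$ have right adjoints $U_i$ and $H_i$. Given any choice of these, let $\eta_i : \mathrm{id} \to H_i F_i$ be the unit of $F_i \dashv H_i$, let $\gamma_i : Q_i U_i \to \mathrm{id}$ be the counit of $Q_i \dashv U_i$, and let $\iota : U_0 H_0 \cong U_1 H_1$ be the canonical isomorphism between these two right adjoints of $F_0 Q_0 = F_1 Q_1$. For $\Theta = (X_0, X_1, \sigma)$ in $\mathcal{D}$ let $V(\Theta)$, with projections $\pi_{i,\Theta} : V(\Theta) \to U_i(X_i)$, be the fiber product in $\mathcal{C}/(\mathcal{L}_0 \cap \mathcal{L}_1)$ of $$U_0(X_0) \xrightarrow{U_0(\eta_{0,X_0})}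 U_0 H_0 F_0(X_0) \xrightarrow{U_0 H_0(\sigma)} U_0 H_0 F_1(X_1) \xrightarrow{\iota_{F_1(X_1)}} U_1 H_1 F_1(X_1)$$ and $U_1(\eta_{1,X_1}) : U_1(X_1) \to U_1 H_1 F_1(X_1)$; this defines a functor $V : \mathcal{D} \to \mathcal{C}/(\mathcal{L}_0 \cap \mathcal{L}_1)$. Then $$\bigl(\gamma_{0,X_0} \circ Q_0(\pi_{0,\Theta}),\ \gamma_{1,X_1} \circ Q_1(\pi_{1,\Theta})\bigr) : R V(\Theta) \to \Theta, \qquad \Theta = (X_0, X_1, \sigma),$$ is a natural isomorphism $R \circ V \cong \mathrm{id}_{\mathcal{D}}$ of functors on $\mathcal{D}$, and $R$ is an equivalence of categories. -/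

import Mathlib

open CategoryTheory CategoryTheory.Limits

universe w v u

noncomputable section

/-- A localizing subcategory of an abelian category: a full subcategory, given by its class of
objects, which is closed under subobjects, quotient objects, extensions and arbitrary (`w`-small)
direct sums. -/
@[ext]
structure LocalizingSubcategory (C : Type u) [Category.{v} C] [Abelian C] where
  /-- the class of objects of the subcategory -/
  prop : ObjectProperty C
  isSerre : prop.IsSerreClass
  closedUnderCoproducts : ∀ ι : Type w, prop.IsClosedUnderColimitsOfShape (Discrete ι)

namespace LocalizingSubcategory

variable {C : Type u} [Category.{v} C] [Abelian C]

instance (L : LocalizingSubcategory.{w} C) : L.prop.IsSerreClass := L.isSerre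

/-- Localizing subcategories are ordered by inclusion. -/
instance : PartialOrder (LocalizingSubcategory.{w} C) where
  le L L' := L.prop ≤ L'.prop
  le_refl L := le_refl L.prop
  le_trans _ _ _ h h' := le_trans (α := ObjectProperty C) h h'
  le_antisymm _ _ h h' := LocalizingSubcategory.ext (le_antisymm (α := ObjectProperty C) h h')

theorem le_def {L L' : LocalizingSubcategory.{w} C} : L ≤ L' ↔ ∀ X, L.prop X → L'.prop X :=
  Iff.rfl

/-- The intersection of a family of localizing subcategories. -/
def sInter (𝒮 : Set (LocalizingSubcategory.{w} C)) : LocalizingSubcategory.{w} C where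
  prop X := ∀ L ∈ 𝒮, L.prop X
  isSerre :=
    { exists_zero := by
        obtain ⟨Z, hZ, _⟩ :=
          ObjectProperty.exists_prop_of_containsZero (⊤ : ObjectProperty C)
        exact ⟨Z, hZ, fun L _ => L.prop.prop_of_isZero hZ⟩
      prop_of_mono := fun f _ hY L hL => L.prop.prop_of_mono f (hY L hL)
      prop_of_epi := fun f _ hX L hL => L.prop.prop_of_epi f (hX L hL)
      prop_X₂_of_shortExact := fun hS h₁ h₃ L hL =>
        L.prop.prop_X₂_of_shortExact hS (h₁ L hL) (h₃ L hL) }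
  closedUnderCoproducts ι :=
    ⟨fun X ⟨p⟩ L hL =>
      (L.closedUnderCoproducts ι).colimitsOfShape_le X
        ⟨{ p with prop_diag_obj := fun j => p.prop_diag_obj j L hL }⟩⟩

/-- The lattice of localizing subcategories: `L₀ ⊓ L₁` is the intersection, and `L₀ ⊔ L₁` is the
smallest localizing subcategory which contains `L₀` and `L₁`. -/
instance : Lattice (LocalizingSubcategory.{w} C) where
  inf L₀ L₁ := sInter {L₀, L₁}
  inf_le_left L₀ L₁ := fun _ h => h L₀ (Or.inl rfl)
  inf_le_right L₀ L₁ := fun _ h => h L₁ (Or.inr rfl)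
  le_inf _ _ _ h₀ h₁ := fun X hX M hM => by
    rcases hM with rfl | rfl
    exacts [h₀ X hX, h₁ X hX]
  sup L₀ L₁ := sInter {M | L₀ ≤ M ∧ L₁ ≤ M}
  le_sup_left _ _ := fun X hX _ hM => hM.1 X hX
  le_sup_right _ _ := fun X hX _ hM => hM.2 X hX
  sup_le _ _ M h₀ h₁ := fun _ hX => hX M ⟨h₀, h₁⟩

/-- A monomorphism `i : X ⟶ Y` is an essential extension if every subobject of `Y` which has zero
intersection with `X` is zero. -/
def IsEssentialExtension {X Y : C} (i : X ⟶ Y) : Prop :=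
  Mono i ∧ ∀ ⦃Z : C⦄ (j : Z ⟶ Y) [Mono j], IsZero (pullback i j) → IsZero Z

/-- A localizing subcategory is stable if it is closed under essential extensions. -/
def IsStable (L : LocalizingSubcategory.{w} C) : Prop :=
  ∀ ⦃X Y : C⦄ (i : X ⟶ Y), IsEssentialExtension i → L.prop X → L.prop Y

/-- The quotient category `C/L`: the localization of `C` at the class of morphisms whose kernel
and cokernel lie in `L`. Its objects are those of `C`. -/
abbrev Quotient (L : LocalizingSubcategory.{w} C) : Type u :=
  L.prop.isoModSerre.Localization

/-- The quotient functor `C ⥤ C/L`. -/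
abbrev toQuotient (L : LocalizingSubcategory.{w} C) : C ⥤ L.Quotient :=
  L.prop.isoModSerre.Q

instance (L : LocalizingSubcategory.{w} C) : Abelian L.Quotient :=
  ObjectProperty.SerreClassLocalization.abelian L.toQuotient L.prop

theorem isInvertedBy {L L' : LocalizingSubcategory.{w} C} (h : L ≤ L') :
    L.prop.isoModSerre.IsInvertedBy L'.toQuotient := fun _ _ f hf =>
  L'.prop.isoModSerre.Q_inverts f ⟨h _ hf.1, h _ hf.2⟩

/-- The natural functor `C/L ⥤ C/L'` for `L ≤ L'`: the unique functor under `C`. -/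
def quotientMap {L L' : LocalizingSubcategory.{w} C} (h : L ≤ L') : L.Quotient ⥤ L'.Quotient :=
  Localization.Construction.lift L'.toQuotient (isInvertedBy h)

theorem toQuotient_quotientMap {L L' : LocalizingSubcategory.{w} C} (h : L ≤ L') :
    L.toQuotient ⋙ quotientMap h = L'.toQuotient :=
  Localization.Construction.fac _ _

theorem quotientMap_comp {L L' L'' : LocalizingSubcategory.{w} C} (h : L ≤ L') (h' : L' ≤ L'') :
    quotientMap h ⋙ quotientMap h' = quotientMap (h.trans h') := by
  apply Localization.Construction.uniq
  rw [← Functor.assoc, toQuotient_quotientMap, toQuotient_quotientMap, toQuotient_quotientMap]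

section Gluing

variable (L₀ L₁ : LocalizingSubcategory.{w} C)

/-- `Q₀ : C/(L₀ ∩ L₁) ⥤ C/L₀`. -/
abbrev Q₀ : (L₀ ⊓ L₁).Quotient ⥤ L₀.Quotient := quotientMap inf_le_left

/-- `Q₁ : C/(L₀ ∩ L₁) ⥤ C/L₁`. -/
abbrev Q₁ : (L₀ ⊓ L₁).Quotient ⥤ L₁.Quotient := quotientMap inf_le_right

/-- `F₀ : C/L₀ ⥤ C/(L₀ ∨ L₁)`. -/
abbrev F₀ : L₀.Quotient ⥤ (L₀ ⊔ L₁).Quotient := quotientMap le_sup_left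

/-- `F₁ : C/L₁ ⥤ C/(L₀ ∨ L₁)`. -/
abbrev F₁ : L₁.Quotient ⥤ (L₀ ⊔ L₁).Quotient := quotientMap le_sup_right

theorem square_eq : Q₀ L₀ L₁ ⋙ F₀ L₀ L₁ = Q₁ L₀ L₁ ⋙ F₁ L₀ L₁ := by
  rw [quotientMap_comp, quotientMap_comp]

/-- The identification of `F₀ Q₀` with `F₁ Q₁`, coming from the equality of these functors. -/
def squareIso : Q₀ L₀ L₁ ⋙ F₀ L₀ L₁ ≅ Q₁ L₀ L₁ ⋙ F₁ L₀ L₁ :=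
  eqToIso (square_eq L₀ L₁)

/-- On an object `X` the identification of `F₀ Q₀` with `F₁ Q₁` is the identity of `X`, viewed as
an object of `C/(L₀ ∨ L₁)`. -/
theorem squareIso_hom_app (X : (L₀ ⊓ L₁).Quotient) :
    (squareIso L₀ L₁).hom.app X = 𝟙 ((F₀ L₀ L₁).obj ((Q₀ L₀ L₁).obj X)) := by
  simp only [squareIso, eqToIso.hom, eqToHom_app]
  rfl

/-- Gabriel's recollement of `C/L₀` and `C/L₁` along `C/(L₀ ∨ L₁)`: objects are triples
`(X₀, X₁, σ)` with `σ : F₀ X₀ ≅ F₁ X₁`, and morphisms are pairs of morphisms compatible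
with the isomorphisms `σ`. -/
abbrev Recollement : Type _ := CategoricalPullback (F₀ L₀ L₁) (F₁ L₀ L₁)

/-- The natural functor `R : C/(L₀ ∩ L₁) ⥤ C/L₀ ×_{C/(L₀ ∨ L₁)} C/L₁`,
`X ↦ (Q₀ X, Q₁ X, id)`. -/
def R : (L₀ ⊓ L₁).Quotient ⥤ Recollement L₀ L₁ where
  obj X := ⟨(Q₀ L₀ L₁).obj X, (Q₁ L₀ L₁).obj X, (squareIso L₀ L₁).app X⟩
  map f := ⟨(Q₀ L₀ L₁).map f, (Q₁ L₀ L₁).map f, (squareIso L₀ L₁).hom.naturality f⟩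
  map_id X := by ext <;> simp
  map_comp f g := by ext <;> simp

/-- A choice of section functors (right adjoints) `U₀, U₁, H₀, H₁` of `Q₀, Q₁, F₀, F₁`. -/
structure SectionFunctors where
  U₀ : L₀.Quotient ⥤ (L₀ ⊓ L₁).Quotient
  U₁ : L₁.Quotient ⥤ (L₀ ⊓ L₁).Quotient
  H₀ : (L₀ ⊔ L₁).Quotient ⥤ L₀.Quotient
  H₁ : (L₀ ⊔ L₁).Quotient ⥤ L₁.Quotient
  adjU₀ : Q₀ L₀ L₁ ⊣ U₀
  adjU₁ : Q₁ L₀ L₁ ⊣ U₁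
  adjH₀ : F₀ L₀ L₁ ⊣ H₀
  adjH₁ : F₁ L₀ L₁ ⊣ H₁

namespace SectionFunctors

variable {L₀ L₁} (S : SectionFunctors L₀ L₁)

/-- The natural isomorphism `ι : U₀ H₀ ≅ U₁ H₁` between the two right adjoints of
`F₀ Q₀ = F₁ Q₁`. -/
def iota : S.H₀ ⋙ S.U₀ ≅ S.H₁ ⋙ S.U₁ :=
  Adjunction.rightAdjointUniq (S.adjU₀.comp S.adjH₀)
    ((S.adjU₁.comp S.adjH₁).ofNatIsoLeft (squareIso L₀ L₁).symm)

/-- The composite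
`U₀ X₀ ⟶ U₀ H₀ F₀ X₀ ⟶ U₀ H₀ F₁ X₁ ⟶ U₁ H₁ F₁ X₁` for `Θ = (X₀, X₁, σ)`. -/
def leftLeg (Θ : Recollement L₀ L₁) :
    S.U₀.obj Θ.fst ⟶ S.U₁.obj (S.H₁.obj ((F₁ L₀ L₁).obj Θ.snd)) :=
  S.U₀.map (S.adjH₀.unit.app Θ.fst) ≫ S.U₀.map (S.H₀.map Θ.iso.hom) ≫
    S.iota.hom.app ((F₁ L₀ L₁).obj Θ.snd)

/-- The unit `U₁ X₁ ⟶ U₁ H₁ F₁ X₁` for `Θ = (X₀, X₁, σ)`. -/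
def rightLeg (Θ : Recollement L₀ L₁) :
    S.U₁.obj Θ.snd ⟶ S.U₁.obj (S.H₁.obj ((F₁ L₀ L₁).obj Θ.snd)) :=
  S.U₁.map (S.adjH₁.unit.app Θ.snd)

theorem leftLeg_naturality {Θ Θ' : Recollement L₀ L₁} (f : Θ ⟶ Θ') :
    S.U₀.map f.fst ≫ S.leftLeg Θ' =
      S.leftLeg Θ ≫ S.U₁.map (S.H₁.map ((F₁ L₀ L₁).map f.snd)) := by
  have h₁ := S.iota.hom.naturality ((F₁ L₀ L₁).map f.snd)
  have h₂ := S.adjH₀.unit.naturality f.fst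
  dsimp at h₁ h₂
  simp only [leftLeg, Category.assoc]
  rw [← h₁, ← S.U₀.map_comp_assoc, h₂]
  simp only [← S.U₀.map_comp_assoc, Category.assoc, ← S.H₀.map_comp,
    CategoricalPullback.Hom.w]

theorem rightLeg_naturality {Θ Θ' : Recollement L₀ L₁} (f : Θ ⟶ Θ') :
    S.U₁.map f.snd ≫ S.rightLeg Θ' =
      S.rightLeg Θ ≫ S.U₁.map (S.H₁.map ((F₁ L₀ L₁).map f.snd)) := by
  have h₂ := S.adjH₁.unit.naturality f.snd
  dsimp at h₂
  simp only [rightLeg, ← S.U₁.map_comp, h₂]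

/-- The functor `V` in the opposite direction: `V Θ` is the fiber product of `U₀ X₀` and `U₁ X₁`
over `U₁ H₁ F₁ X₁`, for `Θ = (X₀, X₁, σ)`. -/
def V : Recollement L₀ L₁ ⥤ (L₀ ⊓ L₁).Quotient where
  obj Θ := pullback (S.leftLeg Θ) (S.rightLeg Θ)
  map {Θ Θ'} f := pullback.map (S.leftLeg Θ) (S.rightLeg Θ) (S.leftLeg Θ') (S.rightLeg Θ')
    (S.U₀.map f.fst) (S.U₁.map f.snd) (S.U₁.map (S.H₁.map ((F₁ L₀ L₁).map f.snd)))
    (S.leftLeg_naturality f).symm (S.rightLeg_naturality f).symm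
  map_id Θ := by apply pullback.hom_ext <;> simp
  map_comp f g := by
    rw [pullback.map_comp]
    simp only [CategoricalPullback.comp_fst, CategoricalPullback.comp_snd, Functor.map_comp]

/-- The projection `π₀ : V Θ ⟶ U₀ X₀`. -/
def π₀ (Θ : Recollement L₀ L₁) : S.V.obj Θ ⟶ S.U₀.obj Θ.fst :=
  pullback.fst (S.leftLeg Θ) (S.rightLeg Θ)

/-- The projection `π₁ : V Θ ⟶ U₁ X₁`. -/
def π₁ (Θ : Recollement L₀ L₁) : S.V.obj Θ ⟶ S.U₁.obj Θ.snd :=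
  pullback.snd (S.leftLeg Θ) (S.rightLeg Θ)

theorem isPullback_V (Θ : Recollement L₀ L₁) :
    IsPullback (S.π₀ Θ) (S.π₁ Θ) (S.leftLeg Θ) (S.rightLeg Θ) :=
  IsPullback.of_hasPullback _ _

theorem V_map_π₀ {Θ Θ' : Recollement L₀ L₁} (f : Θ ⟶ Θ') :
    S.V.map f ≫ S.π₀ Θ' = S.π₀ Θ ≫ S.U₀.map f.fst :=
  pullback.lift_fst _ _ _

theorem V_map_π₁ {Θ Θ' : Recollement L₀ L₁} (f : Θ ⟶ Θ') :
    S.V.map f ≫ S.π₁ Θ' = S.π₁ Θ ≫ S.U₁.map f.snd :=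
  pullback.lift_snd _ _ _

end SectionFunctors

end Gluing

end LocalizingSubcategory

end

/-! `Q₀` and `Q₁` preserve the fiber product defining `V Θ`, and the counits of `Qᵢ ⊣ Uᵢ` are
invertible. So `R (V Θ) ⟶ Θ` is an isomorphism once `Q₀` inverts the right leg `U₁(η₁)` and `Q₁` the
left leg. Comparing the units of the two composite adjunctions (`isIso_map_map_unit_app`) reduces
this to a locality statement: `Q₀ U₁` lands where the unit of `F₀ ⊣ H₀` is invertible, and
symmetrically.

Stability gives this locality. It splits every injective into a torsion and a torsion-free summand,
so modulo `L₁` any object is a kernel of a map of `L₁`-torsion-free injectives. Keeping only their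
`L₀`-torsion-free summands changes the kernel only modulo `L₀` and makes it local for `L₀ ⊔ L₁`
(`exists_isLocal_isLocal_sup`).

Finally, `R` sends the comparison `X ⟶ V (R X)` to a one-sided inverse of an isomorphism, and `Q₀`,
`Q₁` jointly reflect isomorphisms, so `R` is an equivalence. -/

noncomputable section

namespace LocalizingSubcategory

/-! ### Maximal subobjects by exactness of filtered colimits -/

section Complement

variable {C : Type u} [Category.{v} C] [Abelian C] [IsGrothendieckAbelian.{w} C]

/-- In a Grothendieck category, if a directed family of subobjects of `E` consists of objects on
which `p : E ⟶ D` restricts to a monomorphism, then so does `p` on their supremum. -/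
theorem mono_iSup_arrow_comp {E D : C} (p : E ⟶ D) {J : Type w} [Preorder J]
    [IsDirectedOrder J] [Nonempty J] (s : J → Subobject E) (hs : Monotone s)
    (h : ∀ j, Mono ((s j).arrow ≫ p)) : Mono ((⨆ j, s j).arrow ≫ p) := by
  let F : J ⥤ MonoOver E :=
    { obj j := MonoOver.mk (s j).arrow
      map f := MonoOver.homMk (Subobject.ofLE _ _ (hs (leOfHom f))) }
  let G : J ⥤ C := F ⋙ MonoOver.forget _ ⋙ Over.forget _
  let α : G ⟶ (Functor.const J).obj E :=
    { app j := (s j).arrow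
      naturality j j' φ :=
        (Subobject.ofLE_arrow (hs (leOfHom φ))).trans (Category.comp_id _).symm }
  let f : colimit G ⟶ E := colimit.desc G ⟨E, α⟩
  have hf : ∀ j, colimit.ι G j ≫ f = (F.obj j).obj.hom := fun j => colimit.ι_desc _ _
  have hmono := IsGrothendieckAbelian.mono_of_isColimit_monoOver F (colimit.isColimit G) f hf
  have hsup := IsGrothendieckAbelian.subobjectMk_of_isColimit_eq_iSup F (colimit.isColimit G) f hf
  have hsup' : Subobject.mk f = ⨆ j, s j :=
    hsup.trans (iSup_congr fun j => Subobject.mk_arrow (s j))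
  rw [← hsup']
  let β : G ⟶ (Functor.const J).obj D := α ≫ (Functor.const J).map p
  have : ∀ j, Mono (β.app j) := h
  have := NatTrans.mono_of_mono_app β
  have hfp : Mono (f ≫ p) := by
    -- Connectedness makes `D` the colimit of the constant diagram, so `f ≫ p` is a filtered colimit
    -- of the monomorphisms `β.app j`.
    have := IsFiltered.isConnected J
    refine colim.map_mono' β (colimit.isColimit G) (isColimitConstCocone J D) (f ≫ p) fun j => ?_
    exact (Category.assoc _ _ _).symm.trans
      ((congrArg (· ≫ p) (hf j)).trans (Category.comp_id _).symm)
  have : (Subobject.mk f).arrow ≫ p = (Subobject.underlyingIso f).hom ≫ f ≫ p := by simp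
  rw [this]
  infer_instance

/-- Zorn's lemma: a maximal subobject on which `p` is a monomorphism. -/
theorem exists_maximal_mono_comp {E D : C} (p : E ⟶ D) :
    ∃ K : Subobject E, Maximal (fun K : Subobject E => Mono (K.arrow ≫ p)) K := by
  obtain ⟨K, -, hK⟩ := zorn_le_nonempty₀ {K : Subobject E | Mono (K.arrow ≫ p)}
    (fun c hc hchain K hK => by
      -- A Grothendieck category is well-powered, so the chain can be reindexed by a `w`-small type.
      let J := Shrink.{w} c
      let s : J → Subobject E := fun j => ((equivShrink c).symm j : c).1
      let _ : Preorder J := Preorder.lift s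
      have : Nonempty J := ⟨equivShrink c ⟨K, hK⟩⟩
      have : IsDirectedOrder J := ⟨fun a b => by
        rcases hchain.total ((equivShrink c).symm a).2 ((equivShrink c).symm b).2 with h | h
        · exact ⟨b, h, le_refl _⟩
        · exact ⟨a, le_refl _, h⟩⟩
      refine ⟨⨆ j, s j, mono_iSup_arrow_comp p s (fun _ _ h => h)
        (fun j => hc ((equivShrink c).symm j).2), fun z hz => ?_⟩
      have := le_iSup s (equivShrink c ⟨z, hz⟩)
      simpa [s] using this) ⊥ (by
        have : (⊥ : Subobject E).arrow ≫ p = 0 := by simp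
        show Mono _
        exact Preadditive.mono_of_cancel_zero _ fun g _ => by
          rw [← cancel_mono (⊥ : Subobject E).arrow]; simp)
  exact ⟨K, hK⟩

end Complement

/-! ### Torsion subobjects -/

variable {C : Type u} [Category.{v} C] [Abelian C]

/-- An object is torsion-free for `L` if it receives only zero morphisms from objects of `L`. -/
def IsTorsionFree (L : LocalizingSubcategory.{w} C) (J : C) : Prop :=
  ∀ ⦃M : C⦄, L.prop M → ∀ f : M ⟶ J, f = 0

/-- The largest subobject of `E` which belongs to `L`. -/
def torsion [IsGrothendieckAbelian.{w} C] (L : LocalizingSubcategory.{w} C) (E : C) :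
    Subobject E :=
  sSup {A : Subobject E | L.prop (A : C)}

theorem le_torsion [IsGrothendieckAbelian.{w} C] (L : LocalizingSubcategory.{w} C) {E : C}
    {A : Subobject E} (h : L.prop (A : C)) : A ≤ L.torsion E :=
  le_sSup (a := A) h

/-- The supremum is the image of a coproduct of objects of `L`, and `L` is closed under coproducts
and quotients. -/
theorem prop_torsion [IsGrothendieckAbelian.{w} C] (L : LocalizingSubcategory.{w} C) (E : C) :
    L.prop (L.torsion E : C) := by
  let s : Set (Subobject E) := {A : Subobject E | L.prop (A : C)}
  have e : (L.torsion E : C) ≅ image (Subobject.smallCoproductDesc s) :=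
    Subobject.underlyingIso _
  refine L.prop.prop_of_iso e.symm (L.prop.prop_of_epi (factorThruImage _) ?_)
  exact (L.closedUnderCoproducts _).colimitsOfShape_le _
    ⟨{ diag := _
       ι := _
       isColimit := colimit.isColimit _
       prop_diag_obj := fun ⟨j⟩ => by
        obtain ⟨_, a, ha, rfl⟩ := j
        change L.prop (((equivShrink (Subobject E)).symm (equivShrink (Subobject E) a) :
          Subobject E) : C)
        rw [Equiv.symm_apply_apply]
        exact ha }⟩

theorem factors_torsion [IsGrothendieckAbelian.{w} C] (L : LocalizingSubcategory.{w} C) {M E : C}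
    (hM : L.prop M) (f : M ⟶ E) : ∃ g : M ⟶ (L.torsion E : C), g ≫ (L.torsion E).arrow = f := by
  have h : L.prop (Subobject.mk (image.ι f) : C) :=
    L.prop.prop_of_iso (Subobject.underlyingIso _).symm
      (L.prop.prop_of_epi (factorThruImage f) hM)
  refine ⟨factorThruImage f ≫ (Subobject.underlyingIso (image.ι f)).inv ≫
    Subobject.ofLE _ _ (L.le_torsion h), by simp⟩

theorem injective_of_retract {D : Type*} [Category* D] {J E : D} [Injective E] (s : J ⟶ E) (p : E ⟶ J)
    (h : s ≫ p = 𝟙 J) : Injective J where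
  factors g f _ := ⟨Injective.factorThru (g ≫ s) f ≫ p, by
    rw [Injective.comp_factorThru_assoc, Category.assoc, h, Category.comp_id]⟩

/-! ### Splitting the torsion off an injective -/

section Stable

/-- If `K` is maximal among the subobjects of `E` which meet `T` trivially, then `T` is essential
in `E / K`. -/
theorem isEssentialExtension_of_maximal {E : C} (T K : Subobject E)
    (hK : Maximal (fun K : Subobject E => Mono (K.arrow ≫ cokernel.π T.arrow)) K) :
    IsEssentialExtension (T.arrow ≫ cokernel.π K.arrow) := by
  -- This encodes `K ∩ T = 0`.
  have hKm : Mono (K.arrow ≫ cokernel.π T.arrow) := hK.1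
  have hi : Mono (T.arrow ≫ cokernel.π K.arrow) := by
    refine Preadditive.mono_of_cancel_zero _ fun {Z} f hf => ?_
    rw [← Category.assoc] at hf
    have h₁ := Abelian.monoLift_comp K.arrow (f ≫ T.arrow) hf
    have h₂ : Abelian.monoLift K.arrow (f ≫ T.arrow) hf = 0 := by
      rw [← cancel_mono (K.arrow ≫ cokernel.π T.arrow), ← Category.assoc, h₁]
      simp
    rw [h₂, zero_comp] at h₁
    rw [← cancel_mono T.arrow, ← h₁, zero_comp]
  refine ⟨hi, fun Z j _ hZ => ?_⟩
  -- The preimage in `E` of `Z ⊆ E / K`. It meets `T` trivially because `Z` meets the image of `T`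
  -- trivially, so maximality gives `K' = K` and hence `Z = 0`.
  let K' : Subobject E := Subobject.mk (pullback.fst (cokernel.π K.arrow) j)
  have hle : K ≤ K' := by
    refine Subobject.le_mk_of_comm (pullback.lift K.arrow 0 (by simp)) (pullback.lift_fst _ _ _)
  have hK' : Mono (K'.arrow ≫ cokernel.π T.arrow) := by
    refine Preadditive.mono_of_cancel_zero _ fun {W} f hf => ?_
    rw [← Category.assoc] at hf
    have h₁ := Abelian.monoLift_comp T.arrow (f ≫ K'.arrow) hf
    have h₂ : Abelian.monoLift T.arrow (f ≫ K'.arrow) hf ≫ T.arrow ≫ cokernel.π K.arrow =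
        (f ≫ (Subobject.underlyingIso _).hom ≫ pullback.snd (cokernel.π K.arrow) j) ≫ j := by
      rw [← Category.assoc, h₁]
      simp [K', ← pullback.condition]
    have h₃ : Abelian.monoLift T.arrow (f ≫ K'.arrow) hf = 0 := by
      rw [← pullback.lift_fst _ _ h₂, hZ.eq_of_src (pullback.fst _ _) 0, comp_zero]
    rw [h₃, zero_comp] at h₁
    rw [← cancel_mono K'.arrow, ← h₁, zero_comp]
  have h₁ : K' ≤ K := hK.2 hK' hle
  have h₂ : pullback.fst (cokernel.π K.arrow) j ≫ cokernel.π K.arrow = 0 := by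
    have : pullback.fst (cokernel.π K.arrow) j =
        (Subobject.underlyingIso _).inv ≫ Subobject.ofLE _ _ h₁ ≫ K.arrow := by simp [K']
    rw [this, Category.assoc, Category.assoc, cokernel.condition, comp_zero, comp_zero]
  rw [pullback.condition] at h₂
  have h₃ : j = 0 := by
    rw [← cancel_epi (pullback.snd (cokernel.π K.arrow) j), h₂, comp_zero]
  exact IsZero.of_mono_eq_zero j h₃

variable [IsGrothendieckAbelian.{w} C] {L : LocalizingSubcategory.{w} C}

/-- For a stable localizing subcategory, the torsion subobject of an injective object is a
direct summand. -/
theorem exists_retraction_torsion (hL : L.IsStable) (E : C) [Injective E] :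
    ∃ r : E ⟶ (L.torsion E : C), (L.torsion E).arrow ≫ r = 𝟙 _ := by
  obtain ⟨K, hK⟩ := exists_maximal_mono_comp (cokernel.π (L.torsion E).arrow)
  have hess := isEssentialExtension_of_maximal _ _ hK
  let i := (L.torsion E).arrow ≫ cokernel.π K.arrow
  have hi : Mono i := hess.1
  have hQ : L.prop (cokernel K.arrow) := hL _ hess (L.prop_torsion E)
  let g : cokernel K.arrow ⟶ E := Injective.factorThru (L.torsion E).arrow i
  have hg : i ≫ g = (L.torsion E).arrow := Injective.comp_factorThru _ _
  have hgm : Mono g := by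
    refine Preadditive.mono_of_isZero_kernel _ (hess.2 (kernel.ι g) ?_)
    refine IsZero.of_mono_eq_zero (pullback.fst i (kernel.ι g)) ?_
    have h₀ : (pullback.fst i (kernel.ι g) ≫ i) ≫ g = 0 := by
      rw [pullback.condition, Category.assoc, kernel.condition, comp_zero]
    rwa [Category.assoc, hg, ← zero_comp (f := (L.torsion E).arrow), cancel_mono] at h₀
  -- By stability `E / K` is in `L`, so `g` lands in the torsion of `E`; then `E ⟶ E / K ⟶ torsion`
  -- is the retraction.
  obtain ⟨h, hh⟩ := L.factors_torsion hQ g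
  refine ⟨cokernel.π K.arrow ≫ h, ?_⟩
  rw [← cancel_mono (L.torsion E).arrow]
  simp only [Category.assoc, hh, Category.id_comp]
  rw [← Category.assoc]
  exact hg

/-- For a stable localizing subcategory, an injective object has a torsion-free direct summand
with torsion complement. -/
theorem exists_torsionFree_summand (hL : L.IsStable) (E : C) [Injective E] :
    ∃ (J : C) (p : E ⟶ J) (s : J ⟶ E), s ≫ p = 𝟙 J ∧ L.prop.isoModSerre p ∧
      L.IsTorsionFree J := by
  obtain ⟨r, hr⟩ := exists_retraction_torsion hL E
  let t := (L.torsion E).arrow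
  have h₀ : t ≫ (𝟙 E - r ≫ t) = 0 := by
    simp only [Preadditive.comp_sub, Category.comp_id, ← Category.assoc]
    rw [show t ≫ r = 𝟙 _ from hr]
    simp
  -- The idempotent `1 - r ≫ t` kills the torsion, hence descends to a section of `E ⟶ E / T`.
  have hsp : cokernel.desc t (𝟙 E - r ≫ t) h₀ ≫ cokernel.π t = 𝟙 _ := by
    rw [← cancel_epi (cokernel.π t)]
    simp [Preadditive.sub_comp]
  refine ⟨cokernel t, cokernel.π t, cokernel.desc t (𝟙 E - r ≫ t) h₀, hsp, ?_, ?_⟩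
  · rw [ObjectProperty.isoModSerre_iff_of_epi]
    exact L.prop.prop_of_iso (asIso (Abelian.factorThruImage t)) (L.prop_torsion E)
  · intro M hM f
    obtain ⟨g, hg⟩ := L.factors_torsion hM (f ≫ cokernel.desc t (𝟙 E - r ≫ t) h₀)
    rw [← Category.comp_id f, ← hsp, ← Category.assoc, ← hg, Category.assoc,
      cokernel.condition, comp_zero]

end Stable

/-! ### Local objects and torsion-free injectives -/

section Local

variable {L L₀ L₁ : LocalizingSubcategory.{w} C}

/-- Maps to `J` vanish on the kernel and cokernel of `f`. Vanishing on the cokernel gives uniqueness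
of extensions along `f`. Vanishing on the kernel lets a map descend to the coimage, from which
injectivity extends it. -/
theorem isLocal_of_injective {J : C} [Injective J] (hJ : L.IsTorsionFree J) :
    L.prop.isoModSerre.isLocal J := by
  intro X Y f hf
  refine ⟨fun a b hab => ?_, fun g => ?_⟩
  · have h : f ≫ (a - b) = 0 := by simpa [sub_eq_zero] using hab
    rw [← sub_eq_zero, ← cokernel.π_desc f _ h, hJ hf.2 (cokernel.desc f _ h), comp_zero]
  · have h : kernel.ι f ≫ g = 0 := hJ hf.1 _
    refine ⟨Injective.factorThru (cokernel.desc _ g h) (Abelian.factorThruCoimage f), ?_⟩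
    refine (congrArg (· ≫ _) (Abelian.coimage.fac f)).symm.trans ?_
    refine (Category.assoc _ _ _).trans ?_
    rw [Injective.comp_factorThru]
    exact cokernel.π_desc _ _ _

theorem isLocal_kernel {X Y : C} (f : X ⟶ Y) (hX : L.prop.isoModSerre.isLocal X)
    (hY : L.prop.isoModSerre.isLocal Y) : L.prop.isoModSerre.isLocal (kernel f) :=
  ObjectProperty.prop_of_isLimit _ (limit.isLimit (parallelPair f 0)) (by
    rintro (_ | _)
    exacts [hX, hY])

/-- The localizing subcategory of the objects without nonzero morphisms to an injective `J`. -/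
def leftOrthogonal (J : C) [Injective J] : LocalizingSubcategory.{w} C where
  prop M := ∀ f : M ⟶ J, f = 0
  isSerre :=
    { exists_zero := by
        obtain ⟨Z, hZ, _⟩ :=
          ObjectProperty.exists_prop_of_containsZero (⊤ : ObjectProperty C)
        exact ⟨Z, hZ, fun f => hZ.eq_of_src _ _⟩
      prop_of_mono := fun i _ hY f => by
        rw [← Injective.comp_factorThru f i, hY (Injective.factorThru f i), comp_zero]
      prop_of_epi := fun p _ hX f => by
        rw [← cancel_epi p, hX (p ≫ f), comp_zero]
      prop_X₂_of_shortExact := fun {S} hS h₁ h₃ f => by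
        have := hS.epi_g
        rw [← hS.exact.g_desc f (h₁ _), h₃ (hS.exact.desc f (h₁ _)), comp_zero] }
  closedUnderCoproducts ι :=
    ⟨fun X ⟨p⟩ f => p.isColimit.hom_ext fun j => by
      rw [p.prop_diag_obj j (p.ι.app j ≫ f), comp_zero]⟩

/-- Injectivity makes the left orthogonal of `J` a localizing subcategory; containing `L₀` and `L₁`,
it contains their join. -/
theorem IsTorsionFree.sup {J : C} [Injective J] (h₀ : L₀.IsTorsionFree J)
    (h₁ : L₁.IsTorsionFree J) : (L₀ ⊔ L₁).IsTorsionFree J := fun _ hM f =>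
  (sup_le (c := leftOrthogonal.{w} J) (fun _ hX g => h₀ hX g) (fun _ hX g => h₁ hX g) :
    L₀ ⊔ L₁ ≤ leftOrthogonal.{w} J) _ hM f

theorem IsTorsionFree.of_retract {J E : C} (hE : L.IsTorsionFree E) (s : J ⟶ E) (p : E ⟶ J)
    (h : s ≫ p = 𝟙 J) : L.IsTorsionFree J := fun M hM f => by
  rw [← Category.comp_id f, ← h, ← Category.assoc, hE hM (f ≫ s), zero_comp]

/-- The quotient functor preserves kernels and detects isomorphisms modulo `L`; in the quotient this
is the map of kernels induced by isomorphisms. -/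
theorem isoModSerre_kernel_map {X X' Y Y' : C} (f : X ⟶ Y) (f' : X' ⟶ Y') (a : X ⟶ X')
    (b : Y ⟶ Y') (w : f ≫ b = a ≫ f') (ha : L.prop.isoModSerre a) (hb : L.prop.isoModSerre b) :
    L.prop.isoModSerre (kernel.map f f' a b w) := by
  have := ObjectProperty.SerreClassLocalization.preservesFiniteLimits L.toQuotient L.prop
  rw [← ObjectProperty.SerreClassLocalization.isIso_map_iff L.toQuotient] at ha hb ⊢
  have h := kernelComparison_comp_kernel_map f L.toQuotient f' a b w
  have : IsIso (L.toQuotient.map (kernel.map f f' a b w) ≫ kernelComparison f' L.toQuotient) := by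
    rw [← h]
    infer_instance
  exact IsIso.of_isIso_comp_right _ (kernelComparison f' L.toQuotient)

end Local

/-- In a Grothendieck category, every object is isomorphic modulo a stable localizing subcategory
to a kernel of a morphism between torsion-free injective objects. -/
theorem exists_isoModSerre_kernel [IsGrothendieckAbelian.{w} C] {L : LocalizingSubcategory.{w} C}
    (hL : L.IsStable) (X : C) :
    ∃ (I₀ I₁ : C) (d : I₀ ⟶ I₁) (s : X ⟶ kernel d), Injective I₀ ∧ Injective I₁ ∧
      L.IsTorsionFree I₀ ∧ L.IsTorsionFree I₁ ∧ L.prop.isoModSerre s := by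
  -- Embed `X` in an injective and project to its torsion-free summand; the projection has torsion
  -- kernel.
  have aux (X : C) : ∃ (I : C) (f : X ⟶ I), Injective I ∧ L.IsTorsionFree I ∧
      L.prop.monoModSerre f := by
    obtain ⟨J, p, s, hs, hp, hJ⟩ := exists_torsionFree_summand hL (Injective.under X)
    exact ⟨J, Injective.ι X ≫ p, injective_of_retract s p hs, hJ,
      L.prop.monoModSerre.comp_mem _ _ (L.prop.monoModSerre_of_mono _) hp.1⟩
  obtain ⟨I₀, f, hI₀, tI₀, hf⟩ := aux X
  obtain ⟨I₁, g, hI₁, tI₁, hg⟩ := aux (cokernel f)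
  -- `s` is `X ⟶ im f = ker (cokernel.π f)` followed by the inclusion into `ker d`. Factoring `g`
  -- through its image makes each factor visibly invertible modulo `L`.
  refine ⟨I₀, I₁, (cokernel.π f ≫ Abelian.factorThruImage g) ≫ Abelian.image.ι g,
    Abelian.factorThruImage f ≫
      kernel.map (cokernel.π f) (cokernel.π f ≫ Abelian.factorThruImage g) (𝟙 _)
        (Abelian.factorThruImage g) (by simp) ≫ (kernelCompMono _ (Abelian.image.ι g)).inv,
    hI₀, hI₁, tI₀, tI₁, ?_⟩
  refine L.prop.isoModSerre.comp_mem _ _ hf.isoModSerre_factorThruImage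
    (L.prop.isoModSerre.comp_mem _ _ (isoModSerre_kernel_map _ _ _ _ _ ?_
      hg.isoModSerre_factorThruImage) ?_)
  · exact L.prop.isoModSerre_of_isIso _
  · exact L.prop.isoModSerre_of_isIso _

/-- For stable `L₀` and `L₁` there are compatible replacements of an object: by an `L₁`-local
object `Y`, and then, modulo `L₀`, by an object `Y'` which is local for `L₀ ⊔ L₁`. -/
theorem exists_isLocal_isLocal_sup [IsGrothendieckAbelian.{w} C]
    {L₀ L₁ : LocalizingSubcategory.{w} C} (h₀ : L₀.IsStable) (h₁ : L₁.IsStable) (X : C) :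
    ∃ (Y Y' : C) (s : X ⟶ Y) (t : Y ⟶ Y'), L₁.prop.isoModSerre s ∧
      L₁.prop.isoModSerre.isLocal Y ∧ L₀.prop.isoModSerre t ∧
      (L₀ ⊔ L₁).prop.isoModSerre.isLocal Y' := by
  obtain ⟨I₀, I₁, d, s, _, _, tI₀, tI₁, hs⟩ := exists_isoModSerre_kernel h₁ X
  obtain ⟨J₀, p₀, s₀, e₀, hp₀, tJ₀⟩ := exists_torsionFree_summand h₀ I₀
  obtain ⟨J₁, p₁, s₁, e₁, hp₁, tJ₁⟩ := exists_torsionFree_summand h₀ I₁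
  have := injective_of_retract s₀ p₀ e₀
  have := injective_of_retract s₁ p₁ e₁
  -- `J₁` is `L₀`-local and `p₀` is an isomorphism modulo `L₀`, so `d ≫ p₁` extends uniquely along
  -- `p₀`.
  obtain ⟨d', hd'⟩ := (isLocal_of_injective tJ₁ p₀ hp₀).2 (d ≫ p₁)
  exact ⟨kernel d, kernel d', s, kernel.map d d' p₀ p₁ hd'.symm, hs,
    isLocal_kernel _ (isLocal_of_injective tI₀) (isLocal_of_injective tI₁),
    isoModSerre_kernel_map _ _ _ _ _ hp₀ hp₁,
    isLocal_kernel _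
      (isLocal_of_injective (tJ₀.sup (tI₀.of_retract s₀ p₀ e₀)))
      (isLocal_of_injective (tJ₁.sup (tI₁.of_retract s₁ p₁ e₁)))⟩

/-! ### Right adjoints from full faithfulness towards enough objects -/

section Adjunction

variable {A B : Type*} [Category* A] [Category* B]

/-- A functor `F` is fully faithful towards `Z` if it induces bijections on the morphisms
with target `Z`. -/
def IsFullyFaithfulTo (F : A ⥤ B) (Z : A) : Prop :=
  ∀ X : A, Function.Bijective (fun φ : X ⟶ Z => F.map φ)

variable {F : A ⥤ B}

/-- The isomorphism `F.obj Z ≅ b` is terminal among the arrows from `F` to `b`. -/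
theorem isLeftAdjoint_of_isFullyFaithfulTo
    (h : ∀ b : B, ∃ Z : A, IsFullyFaithfulTo F Z ∧ Nonempty (F.obj Z ≅ b)) :
    F.IsLeftAdjoint := by
  have (b : B) : HasTerminal (CostructuredArrow F b) := by
    obtain ⟨Z, hZ, ⟨e⟩⟩ := h b
    have (X : CostructuredArrow F b) : ∃ φ : X.left ⟶ Z, F.map φ = X.hom ≫ e.inv :=
      (hZ X.left).2 _
    choose φ hφ using this
    refine (IsTerminal.ofUniqueHom (Y := CostructuredArrow.mk e.hom)
      (fun X => CostructuredArrow.homMk (φ X) (by simp [hφ])) fun X m => ?_).hasTerminal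
    ext
    apply (hZ X.left).1
    have h₁ : F.map m.left ≫ e.hom = X.hom := CostructuredArrow.w m
    exact ((Iso.eq_comp_inv _).2 h₁).trans (hφ X).symm
  exact isLeftAdjoint_of_costructuredArrowTerminals F

variable {G : B ⥤ A} (adj : F ⊣ G)

theorem IsFullyFaithfulTo.isIso_unit_app {Z : A} (hZ : IsFullyFaithfulTo F Z) :
    IsIso (adj.unit.app Z) := by
  -- The inverse of the unit is the preimage under `F` of the counit at `F.obj Z`.
  obtain ⟨r, hr⟩ := (hZ (G.obj (F.obj Z))).2 (adj.counit.app (F.obj Z))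
  dsimp at hr
  refine ⟨r, (hZ _).1 ?_, ?_⟩
  · simp [hr]
  · apply (adj.homEquiv _ _).symm.injective
    simp [Adjunction.homEquiv_counit, hr]

theorem isIso_counit_app_of_isFullyFaithfulTo
    (h : ∀ b : B, ∃ Z : A, IsFullyFaithfulTo F Z ∧ Nonempty (F.obj Z ≅ b)) (b : B) :
    IsIso (adj.counit.app b) := by
  obtain ⟨Z, hZ, ⟨e⟩⟩ := h b
  have := hZ.isIso_unit_app adj
  have h₁ := adj.left_triangle_components Z
  have h₂ : IsIso (adj.counit.app (F.obj Z)) := by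
    have : IsIso (F.map (adj.unit.app Z) ≫ adj.counit.app (F.obj Z)) := by
      rw [h₁]
      exact IsIso.id _
    exact IsIso.of_isIso_comp_left (F.map (adj.unit.app Z)) _
  exact (NatTrans.isIso_app_iff_of_iso adj.counit e).1 h₂

/-- Two-out-of-three for bijections on morphisms, transported to all sources by essential
surjectivity of `P`. -/
theorem IsFullyFaithfulTo.of_comp_iso {D : Type*} [Category* D] {P : D ⥤ A} {K : D ⥤ B} {Y : D}
    [P.EssSurj] (hP : IsFullyFaithfulTo P Y) (hK : IsFullyFaithfulTo K Y) (e : P ⋙ F ≅ K) :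
    IsFullyFaithfulTo F (P.obj Y) := by
  intro W
  let a := P.objObjPreimageIso W
  have key (f : P.objPreimage W ⟶ Y) : F.map (P.map f) =
      e.hom.app _ ≫ K.map f ≫ e.inv.app Y := by
    simp
  refine ⟨fun φ ψ hφψ => ?_, fun φ => ?_⟩
  · obtain ⟨f, hf⟩ := (hP _).2 (a.hom ≫ φ)
    obtain ⟨g, hg⟩ := (hP _).2 (a.hom ≫ ψ)
    dsimp at hf hg hφψ
    have h₁ : F.map (P.map f) = F.map (P.map g) := by
      rw [hf, hg, Functor.map_comp, Functor.map_comp, hφψ]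
    rw [key, key, cancel_epi, cancel_mono] at h₁
    rw [← cancel_epi a.hom, ← hf, ← hg, (hK _).1 h₁]
  · obtain ⟨f, hf⟩ := (hK _).2 (e.inv.app _ ≫ F.map a.hom ≫ φ ≫ e.hom.app Y)
    dsimp at hf
    refine ⟨a.inv ≫ P.map f, ?_⟩
    dsimp only
    rw [Functor.map_comp, key, hf]
    simp [← Functor.map_comp_assoc]

end Adjunction

/-! ### Section functors of quotient categories -/

variable {L L' : LocalizingSubcategory.{w} C}

/-- `C` has enough objects which are local for `L`. -/
def HasEnoughLocal (L : LocalizingSubcategory.{w} C) : Prop :=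
  ∀ X : C, ∃ (Y : C) (s : X ⟶ Y), L.prop.isoModSerre s ∧ L.prop.isoModSerre.isLocal Y

/-- By calculus of right fractions, a morphism to `Y` is a roof whose denominator is an isomorphism
modulo `L`; locality of `Y` extends the numerator along it. -/
theorem isFullyFaithfulTo_toQuotient {Y : C} (hY : L.prop.isoModSerre.isLocal Y) :
    IsFullyFaithfulTo L.toQuotient Y := by
  intro X
  refine ⟨fun f g hfg => ?_, fun φ => ?_⟩
  · obtain ⟨Z, s, hs, h⟩ :=
      (MorphismProperty.map_eq_iff_precomp L.toQuotient L.prop.isoModSerre f g).1 hfg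
    exact (hY s hs).1 h
  · obtain ⟨ψ, hψ⟩ := Localization.exists_rightFraction L.toQuotient L.prop.isoModSerre φ
    obtain ⟨g, hg⟩ := (hY ψ.s ψ.hs).2 ψ.f
    have := Localization.inverts L.toQuotient L.prop.isoModSerre ψ.s ψ.hs
    refine ⟨g, ?_⟩
    dsimp at hg ⊢
    rw [← cancel_epi (L.toQuotient.map ψ.s), hψ, MorphismProperty.RightFraction.map_s_comp_map,
      ← hg, Functor.map_comp]

theorem isoModSerre_le (h : L ≤ L') : L.prop.isoModSerre ≤ L'.prop.isoModSerre :=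
  fun _ _ _ hf => ⟨h _ hf.1, h _ hf.2⟩

/-- The identification of the quotient functor `C ⥤ C/L'` with `C ⥤ C/L ⥤ C/L'`. -/
def toQuotientIso (h : L ≤ L') : L.toQuotient ⋙ quotientMap h ≅ L'.toQuotient :=
  eqToIso (toQuotient_quotientMap h)

theorem isFullyFaithfulTo_quotientMap (h : L ≤ L') {Y : C}
    (hY : L'.prop.isoModSerre.isLocal Y) :
    IsFullyFaithfulTo (quotientMap h) (L.toQuotient.obj Y) :=
  have := Localization.essSurj L.toQuotient L.prop.isoModSerre
  (isFullyFaithfulTo_toQuotient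
    (MorphismProperty.isLocal_antitone (isoModSerre_le h) _ hY)).of_comp_iso
    (isFullyFaithfulTo_toQuotient hY) (toQuotientIso h)

/-- Every object of `C/L'` comes from an `L'`-local object. -/
theorem HasEnoughLocal.exists_isFullyFaithfulTo (hL' : L'.HasEnoughLocal) (h : L ≤ L')
    (B : L'.Quotient) :
    ∃ Z : L.Quotient, IsFullyFaithfulTo (quotientMap h) Z ∧
      Nonempty ((quotientMap h).obj Z ≅ B) := by
  have := Localization.essSurj L'.toQuotient L'.prop.isoModSerre
  obtain ⟨Y, s, hs, hY⟩ := hL' (L'.toQuotient.objPreimage B)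
  have := Localization.inverts L'.toQuotient L'.prop.isoModSerre s hs
  exact ⟨L.toQuotient.obj Y, isFullyFaithfulTo_quotientMap h hY,
    ⟨(toQuotientIso h).app Y ≪≫ (asIso (L'.toQuotient.map s)).symm ≪≫
      L'.toQuotient.objObjPreimageIso B⟩⟩

theorem HasEnoughLocal.isLeftAdjoint_quotientMap (hL' : L'.HasEnoughLocal) (h : L ≤ L') :
    (quotientMap h).IsLeftAdjoint :=
  isLeftAdjoint_of_isFullyFaithfulTo (hL'.exists_isFullyFaithfulTo h)

theorem HasEnoughLocal.isIso_counit (hL' : L'.HasEnoughLocal) (h : L ≤ L')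
    {U : L'.Quotient ⥤ L.Quotient} (adj : quotientMap h ⊣ U) (B : L'.Quotient) :
    IsIso (adj.counit.app B) :=
  isIso_counit_app_of_isFullyFaithfulTo adj (hL'.exists_isFullyFaithfulTo h) B

theorem preservesFiniteLimits_quotientMap (h : L ≤ L') :
    PreservesFiniteLimits (quotientMap h) := by
  rw [← ObjectProperty.SerreClassLocalization.preservesFiniteLimits_comp_iff L.toQuotient L.prop,
    toQuotient_quotientMap]
  exact ObjectProperty.SerreClassLocalization.preservesFiniteLimits L'.toQuotient L'.prop

/-- The section of `C/L₁` over `C/L` followed by `C/L ⥤ C/L₀` takes values in objects which are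
local for `C/L₀ ⥤ C/M`. -/
theorem isIso_unit_app_quotientMap_obj {L L₀ L₁ M : LocalizingSubcategory.{w} C}
    (a₀ : L ≤ L₀) (a₁ : L ≤ L₁) (b₀ : L₀ ≤ M)
    (H : ∀ X : C, ∃ (Y Y' : C) (s : X ⟶ Y) (t : Y ⟶ Y'), L₁.prop.isoModSerre s ∧
      L₁.prop.isoModSerre.isLocal Y ∧ L₀.prop.isoModSerre t ∧ M.prop.isoModSerre.isLocal Y')
    {U₁ : L₁.Quotient ⥤ L.Quotient} (adjU₁ : quotientMap a₁ ⊣ U₁)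
    {H₀ : M.Quotient ⥤ L₀.Quotient} (adjH₀ : quotientMap b₀ ⊣ H₀) (B : L₁.Quotient) :
    IsIso (adjH₀.unit.app ((quotientMap a₀).obj (U₁.obj B))) := by
  have := Localization.essSurj L₁.toQuotient L₁.prop.isoModSerre
  obtain ⟨Y, Y', s, t, hs, hY, ht, hY'⟩ := H (L₁.toQuotient.objPreimage B)
  have := Localization.inverts L₁.toQuotient L₁.prop.isoModSerre s hs
  have := Localization.inverts L₀.toQuotient L₀.prop.isoModSerre t ht
  have := (isFullyFaithfulTo_quotientMap a₁ hY).isIso_unit_app adjU₁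
  -- The section of `B` is its `L₁`-local model `Y`. In `C/L₀` this is identified through `t` with
  -- `Y'`, which is `M`-local.
  let e₁ : U₁.obj B ≅ L.toQuotient.obj Y :=
    U₁.mapIso ((L₁.toQuotient.objObjPreimageIso B).symm ≪≫ asIso (L₁.toQuotient.map s) ≪≫
      ((toQuotientIso a₁).app Y).symm) ≪≫
      (asIso (adjU₁.unit.app (L.toQuotient.obj Y))).symm
  let e₀ : (quotientMap a₀).obj (U₁.obj B) ≅ L₀.toQuotient.obj Y' :=
    (quotientMap a₀).mapIso e₁ ≪≫ (toQuotientIso a₀).app Y ≪≫ asIso (L₀.toQuotient.map t)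
  exact (NatTrans.isIso_app_iff_of_iso adjH₀.unit e₀).2
    ((isFullyFaithfulTo_quotientMap b₀ hY').isIso_unit_app adjH₀)

/-- Up to isomorphism `f` comes from a morphism of `C`, whose kernel and cokernel then lie in both
`L₀` and `L₁`. -/
theorem isIso_of_isIso_quotientMap {L₀ L₁ : LocalizingSubcategory.{w} C}
    {X Y : (L₀ ⊓ L₁).Quotient} (f : X ⟶ Y) (hf₀ : IsIso ((Q₀ L₀ L₁).map f))
    (hf₁ : IsIso ((Q₁ L₀ L₁).map f)) : IsIso f := by
  obtain ⟨g, ⟨e⟩⟩ := (Localization.essSurj_mapArrow (L₀ ⊓ L₁).toQuotient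
    (L₀ ⊓ L₁).prop.isoModSerre).mem_essImage (Arrow.mk f)
  have aux {L : LocalizingSubcategory.{w} C} (h : L₀ ⊓ L₁ ≤ L)
      (hf : IsIso ((quotientMap h).map f)) : L.prop.isoModSerre g.hom := by
    rw [← ObjectProperty.SerreClassLocalization.isIso_map_iff L.toQuotient]
    have h₁ : IsIso ((quotientMap h).map ((L₀ ⊓ L₁).toQuotient.map g.hom)) :=
      ((MorphismProperty.isomorphisms _).arrow_mk_iso_iff
        ((quotientMap h).mapArrow.mapIso e)).2 hf
    exact ((MorphismProperty.isomorphisms _).arrow_mk_iso_iff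
        (Arrow.isoMk ((toQuotientIso h).app _) ((toQuotientIso h).app _)
          ((toQuotientIso h).hom.naturality g.hom).symm)).1 h₁
  have hg : (L₀ ⊓ L₁).prop.isoModSerre g.hom := by
    have g₀ := aux inf_le_left hf₀
    have g₁ := aux inf_le_right hf₁
    constructor
    · rintro M (rfl | rfl)
      exacts [g₀.1, g₁.1]
    · rintro M (rfl | rfl)
      exacts [g₀.2, g₁.2]
  exact ((MorphismProperty.isomorphisms _).arrow_mk_iso_iff e).1
    (Localization.inverts (L₀ ⊓ L₁).toQuotient (L₀ ⊓ L₁).prop.isoModSerre _ hg)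

/-! ### Mates in a square of adjunctions -/

section Square

variable {A A₀ A₁ B : Type*} [Category* A] [Category* A₀] [Category* A₁] [Category* B]
  {Q₀ : A ⥤ A₀} {Q₁ : A ⥤ A₁} {F₀ : A₀ ⥤ B} {F₁ : A₁ ⥤ B}
  {U₀ : A₀ ⥤ A} {U₁ : A₁ ⥤ A} {H₀ : B ⥤ A₀} {H₁ : B ⥤ A₁}
  (adjU₀ : Q₀ ⊣ U₀) (adjU₁ : Q₁ ⊣ U₁) (adjH₀ : F₀ ⊣ H₀) (adjH₁ : F₁ ⊣ H₁)

/-- If `Q₀ U₁` takes values in the objects at which the unit of `F₀ ⊣ H₀` is invertible, then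
`Q₀ U₁` inverts the unit of `F₁ ⊣ H₁`. -/
theorem isIso_map_map_unit_app (sq : Q₀ ⋙ F₀ ≅ Q₁ ⋙ F₁) (h₀ : ∀ Z, IsIso (adjU₀.counit.app Z))
    (h₁ : ∀ Z, IsIso (adjU₁.counit.app Z)) {Z : A₁}
    (h : IsIso (adjH₀.unit.app (Q₀.obj (U₁.obj Z)))) :
    IsIso (Q₀.map (U₁.map (adjH₁.unit.app Z))) := by
  have hU₁ : IsIso (adjU₁.unit.app (U₁.obj Z)) := by
    have := adjU₁.right_triangle_components Z
    have : IsIso (adjU₁.unit.app (U₁.obj Z) ≫ U₁.map (adjU₁.counit.app Z)) := by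
      rw [this]
      exact IsIso.id _
    exact IsIso.of_isIso_comp_right _ (U₁.map (adjU₁.counit.app Z))
  have hU₀ : IsIso (Q₀.map (adjU₀.unit.app (U₁.obj Z))) := by
    have := adjU₀.left_triangle_components (U₁.obj Z)
    have : IsIso (Q₀.map (adjU₀.unit.app (U₁.obj Z)) ≫ adjU₀.counit.app _) := by
      rw [this]
      exact IsIso.id _
    exact IsIso.of_isIso_comp_right _ (adjU₀.counit.app _)
  -- The units of the two composite adjunctions at `U₁ Z` differ by an isomorphism. `Q₀` inverts the
  -- first by `hU₀` and `h`, hence also the second, whose only factor not yet known to be inverted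
  -- is the one sought, at `Q₁ U₁ Z ≅ Z`.
  have e := Adjunction.unit_rightAdjointUniq_hom_app (adjU₀.comp adjH₀)
    ((adjU₁.comp adjH₁).ofNatIsoLeft sq.symm) (U₁.obj Z)
  have hl : IsIso (Q₀.map ((adjU₀.comp adjH₀).unit.app (U₁.obj Z))) := by
    rw [Adjunction.comp_unit_app, Functor.map_comp]
    infer_instance
  have hr : IsIso (Q₀.map (((adjU₁.comp adjH₁).ofNatIsoLeft sq.symm).unit.app (U₁.obj Z))) := by
    rw [← e, Functor.map_comp]
    infer_instance
  have e' : ((adjU₁.comp adjH₁).ofNatIsoLeft sq.symm).unit.app (U₁.obj Z) =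
      adjU₁.unit.app (U₁.obj Z) ≫ U₁.map (adjH₁.unit.app (Q₁.obj (U₁.obj Z))) ≫
        U₁.map (H₁.map (sq.inv.app (U₁.obj Z))) := by
    simp
  rw [e', Functor.map_comp, Functor.map_comp] at hr
  have h₂ : IsIso (Q₀.map (U₁.map (adjH₁.unit.app (Q₁.obj (U₁.obj Z)))) ≫
      Q₀.map (U₁.map (H₁.map (sq.inv.app (U₁.obj Z))))) :=
    IsIso.of_isIso_comp_left (Q₀.map (adjU₁.unit.app (U₁.obj Z))) _
  have h₃ : IsIso (Q₀.map (U₁.map (adjH₁.unit.app (Q₁.obj (U₁.obj Z))))) :=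
    IsIso.of_isIso_comp_right _ (Q₀.map (U₁.map (H₁.map (sq.inv.app (U₁.obj Z)))))
  have := h₁ Z
  exact (NatTrans.isIso_app_iff_of_iso
    (Functor.whiskerRight (Functor.whiskerRight adjH₁.unit U₁) Q₀)
      (asIso (adjU₁.counit.app Z))).1 h₃

/-- Morphisms `X ⟶ U₀ X₀` and `X ⟶ U₁ X₁` agree in `U₁ H₁ F₁ X₁` if and only if their transposes
are compatible with `σ : F₀ X₀ ⟶ F₁ X₁`. -/
theorem comp_eq_comp_iff_transpose (sq : Q₀ ⋙ F₀ ≅ Q₁ ⋙ F₁) {X : A} {X₀ : A₀} {X₁ : A₁} (σ : F₀.obj X₀ ⟶ F₁.obj X₁)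
    (p₀ : X ⟶ U₀.obj X₀) (p₁ : X ⟶ U₁.obj X₁) :
    p₀ ≫ U₀.map (adjH₀.unit.app X₀) ≫ U₀.map (H₀.map σ) ≫
        (Adjunction.rightAdjointUniq (adjU₀.comp adjH₀)
          ((adjU₁.comp adjH₁).ofNatIsoLeft sq.symm)).hom.app (F₁.obj X₁) =
      p₁ ≫ U₁.map (adjH₁.unit.app X₁) ↔
    F₀.map (Q₀.map p₀ ≫ adjU₀.counit.app X₀) ≫ σ =
      sq.hom.app X ≫ F₁.map (Q₁.map p₁ ≫ adjU₁.counit.app X₁) := by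
  -- Both equations are compared through the hom-set bijection of this adjunction, whose left
  -- adjoint is `Q₀ ⋙ F₀`.
  let adj := (adjU₁.comp adjH₁).ofNatIsoLeft sq.symm
  have hl : adj.homEquiv X (F₁.obj X₁) (F₀.map (Q₀.map p₀ ≫ adjU₀.counit.app X₀) ≫ σ) =
      p₀ ≫ U₀.map (adjH₀.unit.app X₀) ≫ U₀.map (H₀.map σ) ≫
        (Adjunction.rightAdjointUniq (adjU₀.comp adjH₀) adj).hom.app (F₁.obj X₁) := by
    rw [Adjunction.homEquiv_unit,
      ← Adjunction.unit_rightAdjointUniq_hom_app (adjU₀.comp adjH₀) adj X, Category.assoc,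
      ← NatTrans.naturality, ← Category.assoc, ← Adjunction.homEquiv_unit, Adjunction.comp_homEquiv]
    simp [Adjunction.homEquiv_unit]
  have hr : adj.homEquiv X (F₁.obj X₁)
      (sq.hom.app X ≫ F₁.map (Q₁.map p₁ ≫ adjU₁.counit.app X₁)) =
      p₁ ≫ U₁.map (adjH₁.unit.app X₁) := by
    rw [Adjunction.homEquiv_ofNatIsoLeft_apply, Adjunction.comp_homEquiv]
    simp [Adjunction.homEquiv_unit]
  rw [← hl, ← hr]
  exact (adj.homEquiv X (F₁.obj X₁)).apply_eq_iff_eq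

end Square

theorem map_map_counit_app_of_comp_eq_unit {A B : Type*} [Category* A] [Category* B] {F : A ⥤ B}
    {G : B ⥤ A} (adj : F ⊣ G) {X Y : A} {u : X ⟶ Y} {p : Y ⟶ G.obj (F.obj X)}
    (h : u ≫ p = adj.unit.app X) : F.map u ≫ F.map p ≫ adj.counit.app (F.obj X) = 𝟙 _ := by
  rw [← Functor.map_comp_assoc, h, adj.left_triangle_components]

variable {L₀ L₁ : LocalizingSubcategory.{w} C}

theorem IsStable.hasEnoughLocal [IsGrothendieckAbelian.{w} C] {L : LocalizingSubcategory.{w} C}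
    (h : L.IsStable) : L.HasEnoughLocal := fun X => by
  obtain ⟨I₀, I₁, d, s, _, _, t₀, t₁, hs⟩ := exists_isoModSerre_kernel h X
  exact ⟨_, s, hs, isLocal_kernel _ (isLocal_of_injective t₀) (isLocal_of_injective t₁)⟩

theorem hasEnoughLocal_sup [IsGrothendieckAbelian.{w} C] (h₀ : L₀.IsStable) (h₁ : L₁.IsStable) :
    (L₀ ⊔ L₁).HasEnoughLocal := fun X => by
  obtain ⟨Y, Y', s, t, hs, -, ht, hY'⟩ := exists_isLocal_isLocal_sup h₀ h₁ X
  exact ⟨Y', s ≫ t, (L₀ ⊔ L₁).prop.isoModSerre.comp_mem _ _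
    (isoModSerre_le le_sup_right _ hs) (isoModSerre_le le_sup_left _ ht), hY'⟩

theorem nonempty_sectionFunctors [IsGrothendieckAbelian.{w} C] (h₀ : L₀.IsStable)
    (h₁ : L₁.IsStable) : Nonempty (SectionFunctors L₀ L₁) := by
  have := h₀.hasEnoughLocal.isLeftAdjoint_quotientMap (inf_le_left : L₀ ⊓ L₁ ≤ L₀)
  have := h₁.hasEnoughLocal.isLeftAdjoint_quotientMap (inf_le_right : L₀ ⊓ L₁ ≤ L₁)
  have := (hasEnoughLocal_sup h₀ h₁).isLeftAdjoint_quotientMap (le_sup_left : L₀ ≤ L₀ ⊔ L₁)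
  have := (hasEnoughLocal_sup h₀ h₁).isLeftAdjoint_quotientMap (le_sup_right : L₁ ≤ L₀ ⊔ L₁)
  exact ⟨⟨_, _, _, _, Adjunction.ofIsLeftAdjoint _, Adjunction.ofIsLeftAdjoint _,
    Adjunction.ofIsLeftAdjoint _, Adjunction.ofIsLeftAdjoint _⟩⟩

/-! ### The comparison maps are isomorphisms -/

namespace SectionFunctors

variable (S : SectionFunctors L₀ L₁)

/-- The canonical comparison `R (V Θ) ⟶ Θ`. -/
def counitApp (Θ : Recollement L₀ L₁) : (R L₀ L₁).obj (S.V.obj Θ) ⟶ Θ where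
  fst := (Q₀ L₀ L₁).map (S.π₀ Θ) ≫ S.adjU₀.counit.app Θ.fst
  snd := (Q₁ L₀ L₁).map (S.π₁ Θ) ≫ S.adjU₁.counit.app Θ.snd
  w := (comp_eq_comp_iff_transpose S.adjU₀ S.adjU₁ S.adjH₀ S.adjH₁ (squareIso L₀ L₁) _ _ _).1
    (S.isPullback_V Θ).w

/-- The natural transformation `R ∘ V ⟶ id`. -/
def counit : S.V ⋙ R L₀ L₁ ⟶ 𝟭 (Recollement L₀ L₁) where
  app := S.counitApp
  naturality Θ Θ' f := by
    apply CategoricalPullback.hom_ext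
    · change (Q₀ L₀ L₁).map (S.V.map f) ≫ (Q₀ L₀ L₁).map (S.π₀ Θ') ≫ _ =
        ((Q₀ L₀ L₁).map (S.π₀ Θ) ≫ _) ≫ f.fst
      rw [← Functor.map_comp_assoc, V_map_π₀]
      simp
    · change (Q₁ L₀ L₁).map (S.V.map f) ≫ (Q₁ L₀ L₁).map (S.π₁ Θ') ≫ _ =
        ((Q₁ L₀ L₁).map (S.π₁ Θ) ≫ _) ≫ f.snd
      rw [← Functor.map_comp_assoc, V_map_π₁]
      simp

/-- The comparison `X ⟶ V (R X)` whose components are the units of `Q₀ ⊣ U₀` and `Q₁ ⊣ U₁`. -/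
def unitApp (X : (L₀ ⊓ L₁).Quotient) : X ⟶ S.V.obj ((R L₀ L₁).obj X) :=
  (S.isPullback_V ((R L₀ L₁).obj X)).lift (S.adjU₀.unit.app X) (S.adjU₁.unit.app X)
    ((comp_eq_comp_iff_transpose S.adjU₀ S.adjU₁ S.adjH₀ S.adjH₁ (squareIso L₀ L₁) _ _ _).2 (by
      have t₀ := S.adjU₀.left_triangle_components X
      have t₁ := S.adjU₁.left_triangle_components X
      refine (congrArg (fun k => (F₀ L₀ L₁).map k ≫ (squareIso L₀ L₁).hom.app X) t₀).trans
        (Eq.trans ?_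
          (congrArg (fun k => (squareIso L₀ L₁).hom.app X ≫ (F₁ L₀ L₁).map k) t₁).symm)
      rw [CategoryTheory.Functor.map_id, CategoryTheory.Functor.map_id]
      exact (Category.id_comp _).trans (Category.comp_id _).symm))

theorem unitApp_π₀ (X : (L₀ ⊓ L₁).Quotient) :
    S.unitApp X ≫ S.π₀ ((R L₀ L₁).obj X) = S.adjU₀.unit.app X :=
  IsPullback.lift_fst _ _ _ _

theorem unitApp_π₁ (X : (L₀ ⊓ L₁).Quotient) :
    S.unitApp X ≫ S.π₁ ((R L₀ L₁).obj X) = S.adjU₁.unit.app X :=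
  IsPullback.lift_snd _ _ _ _

/-- The natural transformation `id ⟶ V ∘ R`. -/
def unit : 𝟭 (L₀ ⊓ L₁).Quotient ⟶ R L₀ L₁ ⋙ S.V where
  app := S.unitApp
  naturality X Y f := by
    apply (S.isPullback_V ((R L₀ L₁).obj Y)).hom_ext
    · exact (Category.assoc _ _ _).trans ((congrArg (f ≫ ·) (S.unitApp_π₀ Y)).trans
        ((S.adjU₀.unit.naturality f).trans
          ((congrArg (· ≫ S.U₀.map ((Q₀ L₀ L₁).map f)) (S.unitApp_π₀ X)).symm.trans
            ((Category.assoc _ _ _).trans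
              ((congrArg (S.unitApp X ≫ ·) (S.V_map_π₀ ((R L₀ L₁).map f))).symm.trans
                (Category.assoc _ _ _).symm)))))
    · exact (Category.assoc _ _ _).trans ((congrArg (f ≫ ·) (S.unitApp_π₁ Y)).trans
        ((S.adjU₁.unit.naturality f).trans
          ((congrArg (· ≫ S.U₁.map ((Q₁ L₀ L₁).map f)) (S.unitApp_π₁ X)).symm.trans
            ((Category.assoc _ _ _).trans
              ((congrArg (S.unitApp X ≫ ·) (S.V_map_π₁ ((R L₀ L₁).map f))).symm.trans
                (Category.assoc _ _ _).symm)))))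

theorem R_map_unitApp_counitApp (X : (L₀ ⊓ L₁).Quotient) :
    (R L₀ L₁).map (S.unitApp X) ≫ S.counitApp ((R L₀ L₁).obj X) = 𝟙 _ := by
  apply CategoricalPullback.hom_ext
  · exact map_map_counit_app_of_comp_eq_unit S.adjU₀ (S.unitApp_π₀ X)
  · exact map_map_counit_app_of_comp_eq_unit S.adjU₁ (S.unitApp_π₁ X)

variable [IsGrothendieckAbelian.{w} C]

/-- `Q₀ π₀` is a base change of the inverted right leg, and `Q₁ π₁` of the inverted left leg. -/
theorem isIso_counitApp (h₀ : L₀.IsStable) (h₁ : L₁.IsStable)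
    (Θ : Recollement L₀ L₁) : IsIso (S.counitApp Θ) := by
  have c₀ := h₀.hasEnoughLocal.isIso_counit _ S.adjU₀
  have c₁ := h₁.hasEnoughLocal.isIso_counit _ S.adjU₁
  have := preservesFiniteLimits_quotientMap (inf_le_left : L₀ ⊓ L₁ ≤ L₀)
  have := preservesFiniteLimits_quotientMap (inf_le_right : L₀ ⊓ L₁ ≤ L₁)
  have hr : IsIso ((Q₀ L₀ L₁).map (S.rightLeg Θ)) :=
    isIso_map_map_unit_app S.adjU₀ S.adjU₁ S.adjH₀ S.adjH₁ (squareIso L₀ L₁) c₀ c₁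
      (isIso_unit_app_quotientMap_obj inf_le_left inf_le_right le_sup_left
        (exists_isLocal_isLocal_sup h₀ h₁) S.adjU₁ S.adjH₀ _)
  have hl : IsIso ((Q₁ L₀ L₁).map (S.leftLeg Θ)) := by
    have h : IsIso ((Q₁ L₀ L₁).map (S.U₀.map (S.adjH₀.unit.app Θ.fst))) :=
      isIso_map_map_unit_app S.adjU₁ S.adjU₀ S.adjH₁ S.adjH₀ (squareIso L₀ L₁).symm c₁ c₀
        (isIso_unit_app_quotientMap_obj inf_le_right inf_le_left le_sup_right
          (by rw [sup_comm]; exact exists_isLocal_isLocal_sup h₁ h₀) S.adjU₀ S.adjH₁ _)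
    rw [leftLeg, Functor.map_comp]
    infer_instance
  have hπ₀ : IsIso ((Q₀ L₀ L₁).map (S.π₀ Θ)) :=
    ((S.isPullback_V Θ).map (Q₀ L₀ L₁)).isIso_fst_of_isIso
  have hπ₁ : IsIso ((Q₁ L₀ L₁).map (S.π₁ Θ)) :=
    ((S.isPullback_V Θ).map (Q₁ L₀ L₁)).isIso_snd_of_isIso
  exact (CategoricalPullback.isIso_iff _ _ _).2
    ⟨IsIso.comp_isIso' hπ₀ (c₀ _), IsIso.comp_isIso' hπ₁ (c₁ _)⟩

/-- The triangle identity `R_map_unitApp_counitApp` makes `R` invert this map, and its two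
components detect isomorphisms. -/
theorem isIso_unitApp (h₀ : L₀.IsStable) (h₁ : L₁.IsStable)
    (X : (L₀ ⊓ L₁).Quotient) : IsIso (S.unitApp X) := by
  have := S.isIso_counitApp h₀ h₁ ((R L₀ L₁).obj X)
  have h : IsIso ((R L₀ L₁).map (S.unitApp X)) := by
    have : IsIso ((R L₀ L₁).map (S.unitApp X) ≫ S.counitApp ((R L₀ L₁).obj X)) := by
      rw [R_map_unitApp_counitApp]
      exact IsIso.id _
    exact IsIso.of_isIso_comp_right _ (S.counitApp ((R L₀ L₁).obj X))
  obtain ⟨i₀, i₁⟩ := (CategoricalPullback.isIso_iff _ _ _).1 h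
  exact isIso_of_isIso_quotientMap _ i₀ i₁

/-- The natural isomorphism `R ∘ V ≅ id`. -/
def counitIso (h₀ : L₀.IsStable) (h₁ : L₁.IsStable) :
    S.V ⋙ R L₀ L₁ ≅ 𝟭 (Recollement L₀ L₁) :=
  have : ∀ Θ, IsIso (S.counit.app Θ) := S.isIso_counitApp h₀ h₁
  have := NatIso.isIso_of_isIso_app S.counit
  asIso S.counit

theorem isEquivalence_R (S : SectionFunctors L₀ L₁) (h₀ : L₀.IsStable) (h₁ : L₁.IsStable) :
    (R L₀ L₁).IsEquivalence :=
  have : ∀ X, IsIso (S.unit.app X) := S.isIso_unitApp h₀ h₁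
  have := NatIso.isIso_of_isIso_app S.unit
  Functor.IsEquivalence.mk' S.V (asIso S.unit) (S.counitIso h₀ h₁)

end SectionFunctors

end LocalizingSubcategory

end
theorem mainTheorem2 {C : Type u} [Category.{v} C] [Abelian C] [IsGrothendieckAbelian.{w} C]
    (L₀ L₁ : LocalizingSubcategory.{w} C) (h₀ : L₀.IsStable) (h₁ : L₁.IsStable) :
    -- section functors exist
    Nonempty (LocalizingSubcategory.SectionFunctors L₀ L₁) ∧
    -- for every choice of them the explicit formula is a natural isomorphism `R ∘ V ≅ id`
    (∀ S : LocalizingSubcategory.SectionFunctors L₀ L₁,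
      ∃ α : S.V ⋙ LocalizingSubcategory.R L₀ L₁ ≅
          𝟭 (LocalizingSubcategory.Recollement L₀ L₁),
        ∀ Θ : LocalizingSubcategory.Recollement L₀ L₁,
          (α.hom.app Θ).fst =
            (LocalizingSubcategory.Q₀ L₀ L₁).map (S.π₀ Θ) ≫ S.adjU₀.counit.app Θ.fst ∧
          (α.hom.app Θ).snd =
            (LocalizingSubcategory.Q₁ L₀ L₁).map (S.π₁ Θ) ≫ S.adjU₁.counit.app Θ.snd) ∧
    (LocalizingSubcategory.R L₀ L₁).IsEquivalence := by
  have hS := LocalizingSubcategory.nonempty_sectionFunctors h₀ h₁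
  exact ⟨hS, fun S => ⟨S.counitIso h₀ h₁, fun _ => ⟨rfl, rfl⟩⟩, hS.some.isEquivalence_R h₀ h₁⟩
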